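/- Let $1\to N\to G\to Q\to 1$ be a short exact sequence of countable discrete groups, i.e. $N\lhd G$ and $Q=G/N$. Assume that $G$ is residually finite and that $N$ has Kazhdan's property (T). If $G$ is stable in finite actions, then $Q$ is stable in finite actions; and if, in addition, $Q$ is sofic, then $Q$ is residually finite. Here the following terminology is used. For a finite nonempty set $X$ and $\sigma,\tau\in\mathrm{Sym}(X)$ put $d_X(\sigma,\tau)=|\{x\in X:\sigma(x)\ne\tau(x)\}|/|X|$. A sofic approximation of a countable group $\Gamma$ is a sequence of maps $\sigma_n\colon\Gamma\to\mathrm{Sym}(X_n)$, $n\in\mathbb N$, with $X_n$ finite and nonempty, such that $d_{X_n}(\sigma_n(gh),\sigma_n(g)\sigma_n(h))\to 0$ for all $g,h\in\Gamma$ and $d_{X_n}(\sigma_n(g),\mathrm{id})\to 1$ for all $g\in\Gamma\setminus\{e\}$; $\Gamma$ is sofic if it has a sofic approximation. Given a sofic approximation and a nonprincipal ultrafilter $\mathcal U$ on $\mathbb N$, the limit action is the measure preserving action (modulo null sets) of $\Gamma$ on the ultraproduct $\prod_{\mathcal U}X_n$, equipped with the Loeb measure of the normalized counting measures, in which $g$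 acts by $\prod_{\mathcal U}\sigma_n(g)$. A measure preserving action of $\Gamma$ on a probability space $(\Omega,\mu)$ is weakly contained in the class of finite actions if for all measurable $A_1,\dots,A_d\subseteq\Omega$, all finite $F\subseteq\Gamma$ and all $\varepsilon>0$ there are an action of $\Gamma$ on a finite nonempty set $Y$ and subsets $B_1,\dots,B_d\subseteq Y$ with $$\left|\mu(gA_i\cap A_j)-\frac{|gB_i\cap B_j|}{|Y|}\right|<\varepsilon\qquad\text{for all } g\in F,\ 1\le i,j\le d.$$ The group $\Gamma$ is stable in finite actions if for every sofic approximation of $\Gamma$ and every nonprincipal ultrafilter $\mathcal U$ on $\mathbb N$ the limit action is weakly contained in the class of finite actions. -/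

import Mathlib

open Filter Topology MeasureTheory
open scoped ENNReal

noncomputable section

namespace FiniteActions

/-- Normalized counting measure of a subset of a finite set. -/
def dens {X : Type*} (A : Set X) : ℝ := (A.ncard : ℝ) / (Nat.card X : ℝ)

/-- Normalized Hamming distance of two permutations of a finite set. -/
def hammingDistance {X : Type*} (s t : Equiv.Perm X) : ℝ := dens {x | s x ≠ t x}

/-- A sequence of maps `σ n : G → Sym (X n)` to the symmetric groups of finite sets is a sofic
approximation if it is asymptotically multiplicative in the normalized Hamming distance, and every
nontrivial element of `G` asymptotically moves almost all points. -/
structure IsSoficApproximation {G : Type*} [Group G] {X : ℕ → Type}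
    (σ : ∀ n, G → Equiv.Perm (X n)) : Prop where
  mul : ∀ g h : G,
    Tendsto (fun n => hammingDistance (σ n (g * h)) (σ n g * σ n h)) atTop (𝓝 0)
  free : ∀ g : G, g ≠ 1 → Tendsto (fun n => hammingDistance (σ n g) 1) atTop (𝓝 1)

/-- A (countable) group is sofic if it has a sofic approximation on nonempty finite sets. -/
def IsSofic (G : Type*) [Group G] : Prop :=
  ∃ X : ℕ → Type, (∀ n, Finite (X n)) ∧ (∀ n, Nonempty (X n)) ∧
    ∃ σ : ∀ n, G → Equiv.Perm (X n), IsSoficApproximation σ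

/-! ### The Loeb probability space of a sequence of finite sets -/

section Loeb

variable (U : Ultrafilter ℕ) (X : ℕ → Type)

/-- The set-theoretic ultraproduct `∏ X n / U`. -/
def Ultraprod : Type := Filter.Product (U : Filter ℕ) X

variable {X}

/-- The internal subset `∏ A n / U` of the ultraproduct. -/
def internal (A : ∀ n, Set (X n)) : Set (Ultraprod U X) :=
  {x | ∃ f : ∀ n, X n,
    (Quotient.mk (Filter.productSetoid (U : Filter ℕ) X) f : Ultraprod U X) = x ∧
      ∀ᶠ n in (U : Filter ℕ), f n ∈ A n}

theorem mk_mem_internal {A : ∀ n, Set (X n)} {f : ∀ n, X n} :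
    (Quotient.mk (Filter.productSetoid (U : Filter ℕ) X) f : Ultraprod U X) ∈ internal U A ↔
      ∀ᶠ n in (U : Filter ℕ), f n ∈ A n := by
  constructor
  · rintro ⟨f', hf', h⟩
    have h2 : ∀ᶠ n in (U : Filter ℕ), f' n = f n := Quotient.exact hf'
    filter_upwards [h, h2] with n h3 h4
    rwa [← h4]
  · intro h
    exact ⟨f, rfl, h⟩

/-- The limit along `U` of the normalized counting measures of the sets `A n`. -/
def limDens (A : ∀ n, Set (X n)) : ℝ≥0∞ :=
  limUnder (U : Filter ℕ) (fun n => ENNReal.ofReal (dens (A n)))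

theorem tendsto_limDens (A : ∀ n, Set (X n)) :
    Tendsto (fun n => ENNReal.ofReal (dens (A n))) (U : Filter ℕ) (𝓝 (limDens U A)) :=
  (U.map fun n => ENNReal.ofReal (dens (A n))).le_nhds_lim

theorem limDens_empty : limDens U (fun n => (∅ : Set (X n))) = 0 := by
  refine tendsto_nhds_unique (tendsto_limDens U _) ?_
  simp [dens]

theorem limDens_inter_add_diff [∀ n, Finite (X n)] (A B : ∀ n, Set (X n)) :
    limDens U (fun n => A n ∩ B n) + limDens U (fun n => A n \ B n) = limDens U A := by
  refine tendsto_nhds_unique ((tendsto_limDens U _).add (tendsto_limDens U _))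
    ((tendsto_limDens U A).congr fun n => ?_)
  rw [← ENNReal.ofReal_add (by unfold dens; positivity) (by unfold dens; positivity)]
  congr 1
  unfold dens
  rw [← add_div, ← Set.ncard_inter_add_ncard_sdiff_eq_ncard (A n) (B n)]
  push_cast
  rfl

/-- The σ-algebra generated by the internal sets. -/
instance : MeasurableSpace (Ultraprod U X) :=
  MeasurableSpace.generateFrom (Set.range (internal U (X := X)))

variable (X) in
/-- The outer measure `S ↦ inf ∑ k, limDens (A k)`, over all countable covers of `S` by internal
sets `internal (A k)`. -/
def loebOuter : OuterMeasure (Ultraprod U X) :=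
  OuterMeasure.ofFunction
    (fun S => ⨅ (A : ∀ n, Set (X n)) (_ : S ⊆ internal U A), limDens U A)
    (le_antisymm ((iInf₂_le (fun n => (∅ : Set (X n))) (Set.empty_subset _)).trans
      (limDens_empty U).le) bot_le)

theorem le_caratheodory_loebOuter [∀ n, Finite (X n)] :
    (inferInstance : MeasurableSpace (Ultraprod U X)) ≤ (loebOuter U X).caratheodory := by
  refine MeasurableSpace.generateFrom_le ?_
  rintro _ ⟨B, rfl⟩
  show MeasurableSet[(OuterMeasure.ofFunction _ _).caratheodory] (internal U B)
  refine OuterMeasure.ofFunction_caratheodory fun t => ?_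
  refine le_iInf₂ fun A hA => ?_
  rw [← limDens_inter_add_diff U A B]
  refine add_le_add (iInf₂_le _ ?_) (iInf₂_le _ ?_)
  · rintro x ⟨hxt, hxB⟩
    induction x using Quotient.inductionOn with | _ f =>
    exact (mk_mem_internal U).2
      (((mk_mem_internal U).1 (hA hxt)).and ((mk_mem_internal U).1 hxB))
  · rintro x ⟨hxt, hxB⟩
    induction x using Quotient.inductionOn with | _ f =>
    exact (mk_mem_internal U).2 (((mk_mem_internal U).1 (hA hxt)).and
      (Ultrafilter.eventually_not.2 fun h => hxB ((mk_mem_internal U).2 h)))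

variable (X) in
/-- The Loeb measure on the ultraproduct of the finite sets `X n`, each with its normalized
counting measure. -/
def loebMeasure [∀ n, Finite (X n)] : Measure (Ultraprod U X) :=
  (loebOuter U X).toMeasure (le_caratheodory_loebOuter U)

/-- The permutation of the ultraproduct induced by a sequence of permutations. -/
def ultraPerm (s : ∀ n, Equiv.Perm (X n)) : Equiv.Perm (Ultraprod U X) where
  toFun := Quotient.map (fun f n => s n (f n)) fun _ _ h =>
    Filter.Eventually.mono h fun n hn => congrArg (s n) hn
  invFun := Quotient.map (fun f n => (s n).symm (f n)) fun _ _ h =>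
    Filter.Eventually.mono h fun n hn => congrArg (s n).symm hn
  left_inv := by
    intro x
    induction x using Quotient.inductionOn with | _ f =>
    simp only [Quotient.map_mk, Equiv.symm_apply_apply]
    rfl
  right_inv := by
    intro x
    induction x using Quotient.inductionOn with | _ f =>
    simp only [Quotient.map_mk, Equiv.apply_symm_apply]
    rfl

/-- The limit action along `U` of the maps `σ n : G → Sym (X n)`: `g` acts on the Loeb space by
the ultraproduct of the permutations `σ n g`. For an asymptotically multiplicative sequence this
is a measure preserving action modulo null sets. -/
def limitAction {G : Type*} (σ : ∀ n, G → Equiv.Perm (X n)) (g : G) :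
    Equiv.Perm (Ultraprod U X) :=
  ultraPerm U fun n => σ n g

end Loeb

/-- Weak containment (in the sense of Kechris) of a measure preserving action `T` of `G` on the
probability space `(Ω, μ)` in the class of finite `G`-actions: for all measurable sets
`A 1, …, A d`, all finite `F ⊆ G` and all `ε > 0` there are an action `τ` of `G` on a nonempty
finite set `Y`, with its normalized counting measure, and sets `B 1, …, B d ⊆ Y` such that
`|μ (g A i ∩ A j) - |g B i ∩ B j| / |Y|| < ε` for all `g ∈ F` and all `i`, `j`. -/
def WeaklyContainedInFiniteActions {G : Type*} [Group G] {Ω : Type*} [MeasurableSpace Ω]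
    (μ : Measure Ω) (T : G → Equiv.Perm Ω) : Prop :=
  ∀ (d : ℕ) (A : Fin d → Set Ω), (∀ i, MeasurableSet (A i)) →
    ∀ (F : Finset G) (ε : ℝ), 0 < ε →
      ∃ (Y : Type) (_ : Finite Y) (_ : Nonempty Y) (τ : G →* Equiv.Perm Y)
        (B : Fin d → Set Y), ∀ g ∈ F, ∀ i j,
          |μ.real ((T g '' A i) ∩ A j) - dens ((τ g '' B i) ∩ B j)| < ε

/-- A (countable) group is stable in finite actions if for every sofic approximation (on nonempty
finite sets) and every nonprincipal ultrafilter on `ℕ`, the limit action is weakly contained in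
the class of finite actions. -/
def StableInFiniteActions (G : Type*) [Group G] : Prop :=
  ∀ (X : ℕ → Type) [∀ n, Finite (X n)] [∀ n, Nonempty (X n)]
    (σ : ∀ n, G → Equiv.Perm (X n)), IsSoficApproximation σ →
    ∀ U : Ultrafilter ℕ, (U : Filter ℕ) ≤ cofinite →
      WeaklyContainedInFiniteActions (loebMeasure U X) (limitAction U σ)

/-- Kazhdan's property (T) for a countable discrete group `N`: there are a finite `K ⊆ N` and
`κ > 0` such that every unitary representation of `N` with a `(K, κ)`-invariant vector has a
nonzero invariant vector. Hilbert spaces of `Type` suffice: as `N` is countable, one can pass to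
the closed span of the orbit of the almost invariant vector, which is separable. -/
def IsKazhdan (N : Type*) [Group N] : Prop :=
  ∃ (K : Finset N) (κ : ℝ), 0 < κ ∧
    ∀ (H : Type) [NormedAddCommGroup H] [InnerProductSpace ℂ H] [CompleteSpace H]
      (ρ : N →* (H ≃ₗᵢ[ℂ] H)),
      (∃ v : H, v ≠ 0 ∧ ∀ k ∈ K, ‖ρ k v - v‖ < κ * ‖v‖) →
        ∃ w : H, w ≠ 0 ∧ ∀ g : N, ρ g w = w

end FiniteActions

end

/-! Descent of stability. Let `σ` be a sofic approximation of `Q = G ⧸ N` on `X n`. Residual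
finiteness of `G` gives finite `G`-actions on `Z n` in which each nontrivial element eventually has
no fixed point. On `X n × Z n` the maps `σ n (gN) × θ n g` form a sofic approximation of `G`
(`IsSoficApproximation.prod_free`): the first factor carries the whole multiplicativity defect, the
second the freeness. Projection to `X n` preserves Loeb measure (`map_ultraMap_loebMeasure`), so
pullbacks of measurable sets `A i` have the correlations seen by `Q`; in particular `N` fixes them
modulo null sets.

Stability of `G` models these pullbacks by subsets `B i` of a finite `G`-set `Y`, which are then
almost invariant under a Kazhdan set of `N`. Property (T) yields exactly `N`-invariant `C i` close
to `B i`, with an error independent of `Y` (`IsKazhdanPair.exists_invariant_set`). The action on `Y`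
need not factor through `Q`, and counting measure on the orbit space `Y/N` has the wrong weights.
Instead the points of each `N`-orbit are numbered and `G` permutes orbits while keeping the numbers:
this `Q`-action on `Y` moves `N`-invariant sets exactly as before (`exists_quotient_action`).

Residual finiteness. For `q ≠ 1` a sofic approximation yields a set of Loeb measure at least `1/3`
that `q` moves off itself. A finite action modelling its correlations closely cannot have `q` acting
trivially. -/

noncomputable section

namespace FiniteActions

/-! ### Normalized counting measure on finite sets. -/

section Density

variable {X Y : Type*}

theorem dens_nonneg (A : Set X) : 0 ≤ dens A := by
  unfold dens
  positivity

theorem dens_mono [Finite X] {A B : Set X} (h : A ⊆ B) : dens A ≤ dens B :=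
  div_le_div_of_nonneg_right (by exact_mod_cast Set.ncard_le_ncard h) (Nat.cast_nonneg _)

theorem dens_univ [Finite X] [Nonempty X] : dens (Set.univ : Set X) = 1 := by
  have : (Nat.card X : ℝ) ≠ 0 := by exact_mod_cast Nat.card_pos.ne'
  simp [dens, Set.ncard_univ, this]

theorem dens_union_le (A B : Set X) : dens (A ∪ B) ≤ dens A + dens B := by
  unfold dens
  rw [← add_div]
  exact div_le_div_of_nonneg_right (by exact_mod_cast Set.ncard_union_le A B) (Nat.cast_nonneg _)

theorem dens_add_dens_compl [Finite X] [Nonempty X] (A : Set X) : dens A + dens Aᶜ = 1 := by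
  rw [← dens_univ (X := X), ← Set.union_compl_self A]
  unfold dens
  rw [← add_div, Set.ncard_union_eq disjoint_compl_right]
  push_cast
  rfl

theorem dens_image_equiv (e : Equiv.Perm X) (A : Set X) : dens (e '' A) = dens A := by
  unfold dens
  rw [Set.ncard_image_of_injective _ e.injective]

theorem dens_fst_preimage [Finite Y] [Nonempty Y] (A : Set X) :
    dens (Prod.fst ⁻¹' A : Set (X × Y)) = dens A := by
  have h : (Nat.card Y : ℝ) ≠ 0 := by exact_mod_cast Nat.card_pos.ne'
  have : (Prod.fst ⁻¹' A : Set (X × Y)) = A ×ˢ Set.univ := by ext; simp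
  unfold dens
  rw [this, Set.ncard_prod, Set.ncard_univ, Nat.card_prod]
  push_cast
  rw [mul_div_mul_right _ _ h]

theorem abs_dens_sub_le [Finite X] (A B : Set X) : |dens A - dens B| ≤ dens (symmDiff A B) := by
  have key : ∀ A B : Set X, dens A ≤ dens B + dens (symmDiff A B) := fun A B =>
    (dens_mono (B := B ∪ symmDiff A B) fun x hx => by
      by_cases h : x ∈ B
      · exact Or.inl h
      · exact Or.inr (Or.inl ⟨hx, h⟩)).trans (dens_union_le _ _)
  rw [abs_le]
  have h1 := key A B
  have h2 := key B A
  rw [symmDiff_comm] at h2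
  constructor <;> linarith

end Density

/-! ### The Loeb measure is a probability measure with the expected values on internal sets. -/

section Loeb

variable (U : Ultrafilter ℕ) {X : ℕ → Type}

theorem measurableSet_internal (A : ∀ n, Set (X n)) : MeasurableSet (internal U A) :=
  MeasurableSpace.measurableSet_generateFrom ⟨A, rfl⟩

theorem internal_compl (A : ∀ n, Set (X n)) :
    (internal U A)ᶜ = internal U (fun n => (A n)ᶜ) := by
  ext x
  induction x using Quotient.inductionOn with | _ f =>
  exact (not_congr (mk_mem_internal U)).trans
    (Ultrafilter.eventually_not.symm.trans
      (mk_mem_internal U (A := fun n => (A n)ᶜ) (f := f)).symm)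

theorem loebOuter_internal_le (A : ∀ n, Set (X n)) :
    loebOuter U X (internal U A) ≤ limDens U A :=
  (OuterMeasure.ofFunction_le _).trans (iInf₂_le A (Set.Subset.refl _))

theorem limDens_eq_zero {A : ∀ n, Set (X n)} (hU : (U : Filter ℕ) ≤ cofinite)
    (h : Tendsto (fun n => dens (A n)) atTop (𝓝 0)) : limDens U A = 0 := by
  refine tendsto_nhds_unique (tendsto_limDens U A) ?_
  rw [← ENNReal.ofReal_zero]
  exact (ENNReal.continuous_ofReal.tendsto _).comp
    (h.mono_left (hU.trans Nat.cofinite_eq_atTop.le))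

/-- Countable saturation of the ultraproduct, for a sequence of internal sets. -/
theorem exists_forall_notMem_internal [∀ n, Nonempty (X n)]
    (hU : (U : Filter ℕ) ≤ cofinite)
    (A : ℕ → ∀ n, Set (X n))
    (h : ∀ K, ∀ᶠ n in (U : Filter ℕ), ∃ x : X n, ∀ k < K, x ∉ A k n) :
    ∃ x : Ultraprod U X, ∀ k, x ∉ internal U (A k) := by
  classical
  let P : ℕ → ℕ → Prop := fun n K => ∃ x : X n, ∀ k < K, x ∉ A k n
  have hP0 : ∀ n, P n 0 := fun n => ⟨Classical.arbitrary _, fun k hk => absurd hk (Nat.not_lt_zero k)⟩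
  -- Diagonal choice: `f n` avoids the longest initial run of the sets, of length at most `n`, that
  -- can be avoided simultaneously.
  choose f hf using fun n => Nat.findGreatest_spec (P := P n) (Nat.zero_le n) (hP0 n)
  refine ⟨Quotient.mk _ f, fun k => ?_⟩
  refine (not_congr (mk_mem_internal U)).2 (Ultrafilter.eventually_not.1 ?_)
  have hk : ∀ᶠ n in (U : Filter ℕ), k + 1 ≤ n :=
    (eventually_ge_atTop (k + 1)).filter_mono (hU.trans Nat.cofinite_eq_atTop.le)
  filter_upwards [h (k + 1), hk] with n hn hkn
  exact hf n k (Nat.lt_of_succ_le (Nat.le_findGreatest hkn hn))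

variable [∀ n, Finite (X n)]

theorem loebMeasure_apply {S : Set (Ultraprod U X)} (hS : MeasurableSet S) :
    loebMeasure U X S = loebOuter U X S :=
  toMeasure_apply _ _ hS

theorem loebMeasure_internal_le (A : ∀ n, Set (X n)) :
    loebMeasure U X (internal U A) ≤ limDens U A := by
  rw [loebMeasure_apply U (measurableSet_internal U A)]
  exact loebOuter_internal_le U A

variable [∀ n, Nonempty (X n)]

theorem limDens_univ : limDens U (fun n => (Set.univ : Set (X n))) = 1 := by
  refine tendsto_nhds_unique (tendsto_limDens U _) ?_
  simp [dens_univ]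

theorem limDens_add_limDens_compl (A : ∀ n, Set (X n)) :
    limDens U A + limDens U (fun n => (A n)ᶜ) = 1 := by
  refine tendsto_nhds_unique ((tendsto_limDens U _).add (tendsto_limDens U _)) ?_
  refine tendsto_const_nhds.congr fun n => ?_
  rw [← ENNReal.ofReal_add (dens_nonneg _) (dens_nonneg _), dens_add_dens_compl,
    ENNReal.ofReal_one]

/-- If the sum were below 1, then for each `K` the first `K` sets would have total density below 1
for `U`-most `n` and miss a point of `X n`. Saturation would then give a point of the ultraproduct
outside every internal set. -/
theorem one_le_tsum_limDens (hU : (U : Filter ℕ) ≤ cofinite) (A : ℕ → ∀ n, Set (X n))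
    (h : Set.univ ⊆ ⋃ k, internal U (A k)) : 1 ≤ ∑' k, limDens U (A k) := by
  by_contra! hlt
  obtain ⟨x, hx⟩ := exists_forall_notMem_internal U hU A fun K => by
    have hK : ∑ k ∈ Finset.range K, limDens U (A k) < 1 :=
      (ENNReal.sum_le_tsum _).trans_lt hlt
    have ht := tendsto_finsetSum (Finset.range K) fun k _ => tendsto_limDens U (A k)
    filter_upwards [ht.eventually_lt_const hK] with n hn
    by_contra! hcov
    rw [← ENNReal.ofReal_sum_of_nonneg fun k _ => dens_nonneg _,
      ENNReal.ofReal_lt_one] at hn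
    have hle : ∀ s : Finset ℕ, dens (⋃ k ∈ s, A k n) ≤ ∑ k ∈ s, dens (A k n) := by
      intro s
      induction s using Finset.induction_on with
      | empty => simp [dens]
      | insert a s ha ih =>
        rw [Finset.set_biUnion_insert, Finset.sum_insert ha]
        exact (dens_union_le _ _).trans (by gcongr)
    refine absurd (hle (Finset.range K)) (not_le.2 (hn.trans_le ?_))
    rw [← dens_univ (X := X n)]
    refine dens_mono fun x _ => ?_
    obtain ⟨k, hk, hx⟩ := hcov x
    exact Set.mem_biUnion (Finset.mem_coe.2 (Finset.mem_range.2 hk)) hx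
  obtain ⟨k, hk⟩ := Set.mem_iUnion.1 (h (Set.mem_univ x))
  exact hx k hk

theorem loebMeasure_univ (hU : (U : Filter ℕ) ≤ cofinite) : loebMeasure U X Set.univ = 1 := by
  refine le_antisymm ?_ ?_
  · have h : internal U (fun n => (Set.univ : Set (X n))) = Set.univ := by
      refine Set.eq_univ_of_forall fun x => ?_
      induction x using Quotient.inductionOn with | _ f =>
      exact (mk_mem_internal U).2 (Eventually.of_forall fun _ => Set.mem_univ _)
    rw [← h, ← limDens_univ U (X := X)]
    exact loebMeasure_internal_le U _
  · rw [loebMeasure_apply U MeasurableSet.univ, loebOuter, OuterMeasure.ofFunction_apply]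
    refine le_iInf₂ fun t ht => ?_
    -- An arbitrary cover is enlarged to a cover by internal sets at total cost `ε`, to which the
    -- saturation bound applies.
    refine ENNReal.le_of_forall_pos_le_add fun ε hε _ => ?_
    obtain ⟨δ, hδ, hsum⟩ := ENNReal.exists_pos_sum_of_countable
      (ENNReal.coe_ne_zero.2 hε.ne') ℕ
    have hA : ∀ k, ∃ A : ∀ n, Set (X n), t k ⊆ internal U A ∧
        limDens U A ≤ (⨅ (A : ∀ n, Set (X n)) (_ : t k ⊆ internal U A), limDens U A) + δ k := by
      intro k
      by_contra! hcon
      rcases eq_or_ne (⨅ (A : ∀ n, Set (X n)) (_ : t k ⊆ internal U A), limDens U A) ⊤ with h | h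
      · have := hcon (fun _ => Set.univ) fun x _ => by
          induction x using Quotient.inductionOn with | _ f =>
          exact (mk_mem_internal U).2 (Eventually.of_forall fun _ => Set.mem_univ _)
        rw [h, top_add] at this
        exact not_top_lt this
      · exact absurd (le_iInf₂ fun A hA => (hcon A hA).le)
          (not_le.2 (ENNReal.lt_add_right h (ENNReal.coe_ne_zero.2 (hδ k).ne')))
    choose A hA hle using hA
    calc 1 ≤ ∑' k, limDens U (A k) :=
          one_le_tsum_limDens U hU A (ht.trans (Set.iUnion_mono hA))
      _ ≤ ∑' k, ((⨅ (A : ∀ n, Set (X n)) (_ : t k ⊆ internal U A), limDens U A) + δ k) :=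
          ENNReal.tsum_le_tsum hle
      _ ≤ _ := by
          rw [ENNReal.tsum_add]
          gcongr

theorem isProbabilityMeasure_loebMeasure (hU : (U : Filter ℕ) ≤ cofinite) :
    IsProbabilityMeasure (loebMeasure U X) :=
  ⟨loebMeasure_univ U hU⟩

/-- The upper bound is built into the outer measure. It also holds for the complement, which is
internal, and both pairs of values sum to 1, so neither bound can be strict. -/
theorem loebMeasure_internal (hU : (U : Filter ℕ) ≤ cofinite) (A : ∀ n, Set (X n)) :
    loebMeasure U X (internal U A) = limDens U A := by
  have := isProbabilityMeasure_loebMeasure U (X := X) hU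
  refine le_antisymm (loebMeasure_internal_le U A) ?_
  have h1 := limDens_add_limDens_compl U A
  have h2 := prob_add_prob_compl (μ := loebMeasure U X) (measurableSet_internal U A)
  rw [internal_compl] at h2
  have h3 := loebMeasure_internal_le U fun n => (A n)ᶜ
  have h4 : limDens U (fun n => (A n)ᶜ) ≠ ⊤ :=
    ne_top_of_le_ne_top ENNReal.one_ne_top (h1 ▸ le_add_self)
  refine (ENNReal.add_le_add_iff_right h4).1 ?_
  rw [h1, ← h2]
  gcongr

end Loeb

/-! ### Functoriality of the Loeb space. -/

section Map

variable (U : Ultrafilter ℕ) {X Y : ℕ → Type}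

/-- The map of ultraproducts induced by a sequence of maps. -/
def ultraMap (p : ∀ n, X n → Y n) : Ultraprod U X → Ultraprod U Y :=
  Quotient.map (fun f n => p n (f n)) fun _ _ h =>
    Filter.Eventually.mono h fun n hn => congrArg (p n) hn

theorem ultraMap_preimage_internal (p : ∀ n, X n → Y n) (A : ∀ n, Set (Y n)) :
    ultraMap U p ⁻¹' internal U A = internal U (fun n => p n ⁻¹' A n) := by
  ext x
  induction x using Quotient.inductionOn with | _ f =>
  exact (mk_mem_internal U (f := fun n => p n (f n))).trans
    (mk_mem_internal U (A := fun n => p n ⁻¹' A n) (f := f)).symm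

theorem measurable_ultraMap (p : ∀ n, X n → Y n) : Measurable (ultraMap U p) := by
  refine measurable_generateFrom ?_
  rintro _ ⟨A, rfl⟩
  rw [ultraMap_preimage_internal]
  exact measurableSet_internal U _

theorem ultraMap_ultraPerm (p : ∀ n, X n → Y n) (s : ∀ n, Equiv.Perm (X n))
    (t : ∀ n, Equiv.Perm (Y n)) (h : ∀ n x, p n (s n x) = t n (p n x)) (x : Ultraprod U X) :
    ultraMap U p (ultraPerm U s x) = ultraPerm U t (ultraMap U p x) := by
  induction x using Quotient.inductionOn with | _ f =>
  exact congrArg (Quotient.mk _) (funext fun n => h n (f n))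

theorem ultraPerm_image_preimage (p : ∀ n, X n → Y n) (s : ∀ n, Equiv.Perm (X n))
    (t : ∀ n, Equiv.Perm (Y n)) (h : ∀ n x, p n (s n x) = t n (p n x)) (A : Set (Ultraprod U Y)) :
    ultraPerm U s '' (ultraMap U p ⁻¹' A) = ultraMap U p ⁻¹' (ultraPerm U t '' A) := by
  ext x
  obtain ⟨y, rfl⟩ := (ultraPerm U s).surjective x
  rw [(ultraPerm U s).injective.mem_set_image, Set.mem_preimage, Set.mem_preimage,
    ultraMap_ultraPerm U p s t h, (ultraPerm U t).injective.mem_set_image]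

theorem measurableSet_ultraPerm_image (s : ∀ n, Equiv.Perm (X n)) {A : Set (Ultraprod U X)}
    (hA : MeasurableSet A) : MeasurableSet (ultraPerm U s '' A) := by
  rw [Equiv.image_eq_preimage_symm]
  exact measurable_ultraMap U (fun n => (s n).symm) hA

/-- Pulling back internal covers gives one inequality between the measures; for probability measures
this forces equality. -/
theorem map_ultraMap_loebMeasure [∀ n, Finite (X n)] [∀ n, Nonempty (X n)] [∀ n, Finite (Y n)]
    [∀ n, Nonempty (Y n)] (hU : (U : Filter ℕ) ≤ cofinite) (p : ∀ n, X n → Y n)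
    (hp : ∀ n (A : Set (Y n)), dens (p n ⁻¹' A) = dens A) :
    (loebMeasure U X).map (ultraMap U p) = loebMeasure U Y := by
  have := isProbabilityMeasure_loebMeasure U (X := X) hU
  have := isProbabilityMeasure_loebMeasure U (X := Y) hU
  have := Measure.isProbabilityMeasure_map (μ := loebMeasure U X)
    (measurable_ultraMap U p).aemeasurable
  refine Measure.eq_of_le_of_isProbabilityMeasure (Measure.le_iff.2 fun S hS => ?_)
  rw [Measure.map_apply (measurable_ultraMap U p) hS, loebMeasure_apply U hS,
    loebMeasure_apply U (measurable_ultraMap U p hS), ← OuterMeasure.map_apply]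
  refine OuterMeasure.le_ofFunction.2 (fun S => le_iInf₂ fun A hA => ?_) S
  rw [OuterMeasure.map_apply]
  refine (measure_mono (Set.preimage_mono hA)).trans ?_
  rw [ultraMap_preimage_internal]
  refine (loebOuter_internal_le U _).trans_eq ?_
  unfold limDens
  simp_rw [hp]

end Map

/-! ### The identity element in the limit action. -/

section LimitAction

variable {G : Type*} [Group G] {X : ℕ → Type} {σ : ∀ n, G → Equiv.Perm (X n)}

theorem IsSoficApproximation.tendsto_one (hσ : IsSoficApproximation σ) :
    Tendsto (fun n => dens {x | σ n 1 x ≠ x}) atTop (𝓝 0) := by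
  refine (hσ.mul 1 1).congr fun n => ?_
  unfold hammingDistance
  congr 1
  ext x
  rw [mul_one, Set.mem_ofPred_eq, Set.mem_ofPred_eq, Equiv.Perm.mul_apply, not_iff_not,
    (σ n 1).injective.eq_iff, eq_comm]

/-- The permutation `σ n 1` is only asymptotically the identity, so `1` acts trivially only off a
null set. This lets the correlation of a set with itself at `1` be read as its measure. -/
theorem IsSoficApproximation.loebMeasure_real_image_one_inter [∀ n, Finite (X n)]
    (hσ : IsSoficApproximation σ) (U : Ultrafilter ℕ) (hU : (U : Filter ℕ) ≤ cofinite)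
    (A : Set (Ultraprod U X)) :
    (loebMeasure U X).real (limitAction U σ 1 '' A ∩ A) = (loebMeasure U X).real A := by
  refine measureReal_congr ?_
  have h0 : loebMeasure U X (internal U fun n => {x | σ n 1 x ≠ x}) = 0 :=
    le_antisymm ((loebMeasure_internal_le U _).trans
      (limDens_eq_zero U hU hσ.tendsto_one).le) bot_le
  have hfix : ∀ᵐ x ∂loebMeasure U X, limitAction U σ 1 x = x := by
    refine measure_mono_null (fun x hx => ?_) h0
    induction x using Quotient.inductionOn with | _ f =>
    refine (mk_mem_internal U).2 (Ultrafilter.eventually_not.2 fun h => hx ?_)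
    exact Quotient.sound h
  filter_upwards [hfix] with x hx
  refine propext ⟨fun h => h.2, fun h => ⟨⟨x, h, hx⟩, h⟩⟩

end LimitAction

/-! ### Property (T): almost invariant sets are near invariant ones. -/

section Kazhdan

/-- `(K, κ)` is a Kazhdan pair for representations on Hilbert spaces of `Type`. -/
def IsKazhdanPair {N : Type*} [Group N] (K : Finset N) (κ : ℝ) : Prop :=
  ∀ (H : Type) [NormedAddCommGroup H] [InnerProductSpace ℂ H] [CompleteSpace H]
    (ρ : N →* (H ≃ₗᵢ[ℂ] H)),
    (∃ v : H, v ≠ 0 ∧ ∀ k ∈ K, ‖ρ k v - v‖ < κ * ‖v‖) →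
      ∃ w : H, w ≠ 0 ∧ ∀ g : N, ρ g w = w

variable {N : Type*} [Group N]

section Representation

variable {H : Type} [NormedAddCommGroup H] [InnerProductSpace ℂ H]

/-- The subspace of invariant vectors. -/
def invariantVectors (ρ : N →* (H ≃ₗᵢ[ℂ] H)) : Submodule ℂ H where
  carrier := {v | ∀ g, ρ g v = v}
  add_mem' ha hb g := by rw [map_add, ha g, hb g]
  zero_mem' g := map_zero _
  smul_mem' c v hv g := by rw [map_smul, hv g]

theorem apply_mem_orthogonal_invariantVectors (ρ : N →* (H ≃ₗᵢ[ℂ] H)) (g : N) {v : H}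
    (hv : v ∈ (invariantVectors ρ)ᗮ) : ρ g v ∈ (invariantVectors ρ)ᗮ := by
  rw [Submodule.mem_orthogonal] at hv ⊢
  intro u hu
  rw [← hu g, LinearIsometryEquiv.inner_map_map]
  exact hv u hu

/-- The representation on the orthogonal complement of the invariant vectors. -/
def orthogonalRep (ρ : N →* (H ≃ₗᵢ[ℂ] H)) :
    N →* ((invariantVectors ρ)ᗮ ≃ₗᵢ[ℂ] (invariantVectors ρ)ᗮ) where
  toFun g :=
    { toFun := fun v => ⟨ρ g v, apply_mem_orthogonal_invariantVectors ρ g v.2⟩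
      invFun := fun v => ⟨ρ g⁻¹ v, apply_mem_orthogonal_invariantVectors ρ g⁻¹ v.2⟩
      map_add' := fun v w => Subtype.ext (map_add (ρ g) _ _)
      map_smul' := fun c v => Subtype.ext (map_smul (ρ g) _ _)
      left_inv := fun v => Subtype.ext <| by
        change (ρ g⁻¹ * ρ g) (v : H) = v
        rw [← map_mul, inv_mul_cancel, map_one]
        rfl
      right_inv := fun v => Subtype.ext <| by
        change (ρ g * ρ g⁻¹) (v : H) = v
        rw [← map_mul, mul_inv_cancel, map_one]
        rfl
      norm_map' := fun v => (ρ g).norm_map v }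
  map_one' := by
    ext v
    change ρ 1 (v : H) = v
    rw [map_one]
    rfl
  map_mul' g h := by
    ext v
    change ρ (g * h) (v : H) = ρ g (ρ h v)
    rw [map_mul]
    rfl

/-- Take `w` to be the orthogonal projection of `v` to the invariant vectors. The representation on
the orthogonal complement has no nonzero invariant vector, so `v - w`, which is displaced exactly as
much as `v`, cannot be `(K, κ)`-invariant. -/
theorem IsKazhdanPair.exists_invariant_near {K : Finset N} {κ : ℝ} (h : IsKazhdanPair K κ)
    [FiniteDimensional ℂ H] (ρ : N →* (H ≃ₗᵢ[ℂ] H)) (v : H) :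
    ∃ w : H, (∀ g, ρ g w = w) ∧
      ∀ δ : ℝ, 0 ≤ δ → (∀ k ∈ K, ‖ρ k v - v‖ ≤ δ) → κ * ‖v - w‖ ≤ δ := by
  have : CompleteSpace H := FiniteDimensional.complete ℂ H
  have : CompleteSpace (invariantVectors ρ)ᗮ := FiniteDimensional.complete ℂ _
  set w := (invariantVectors ρ).starProjection v
  have hw : ∀ g, ρ g w = w := (invariantVectors ρ).starProjection_apply_mem v
  refine ⟨w, hw, fun δ hδ hK => ?_⟩
  by_contra! hlt
  let u : (invariantVectors ρ)ᗮ :=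
    ⟨v - w, Submodule.sub_starProjection_mem_orthogonal v⟩
  have hu : ‖u‖ = ‖v - w‖ := rfl
  obtain ⟨z, hz0, hz⟩ := h _ (orthogonalRep ρ) ⟨u, fun h0 => by
      rw [h0, norm_zero] at hu
      rw [← hu, mul_zero] at hlt
      exact absurd hlt (not_lt.2 hδ), fun k hk => by
    have : ‖orthogonalRep ρ k u - u‖ = ‖ρ k v - v‖ := by
      change ‖ρ k (v - w) - (v - w)‖ = _
      rw [map_sub, hw k, sub_sub_sub_cancel_right]
    rw [this, hu]
    exact (hK k hk).trans_lt hlt⟩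
  refine hz0 (Subtype.ext ?_)
  have hz1 : (z : H) ∈ invariantVectors ρ := fun g => congrArg Subtype.val (hz g)
  exact inner_self_eq_zero.1 ((Submodule.mem_orthogonal _ _).1 z.2 z hz1)

end Representation

variable {Y : Type}

/-- The permutation representation on `ℓ²(Y)` of an action on a finite set `Y`. -/
def permRep [Fintype Y] (τ : N →* Equiv.Perm Y) :
    N →* (EuclideanSpace ℂ Y ≃ₗᵢ[ℂ] EuclideanSpace ℂ Y) where
  toFun g := LinearIsometryEquiv.piLpCongrLeft 2 ℂ ℂ (τ g)
  map_one' := by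
    ext v y
    rw [map_one]
    rfl
  map_mul' g h := by
    ext v y
    rw [map_mul]
    rfl

theorem permRep_apply [Fintype Y] (τ : N →* Equiv.Perm Y) (g : N) (v : EuclideanSpace ℂ Y)
    (y : Y) : permRep τ g v y = v ((τ g).symm y) := rfl

theorem norm_sq_le_ncard [Fintype Y] {v : EuclideanSpace ℂ Y} {S : Set Y}
    (h0 : ∀ y ∉ S, v y = 0) (h1 : ∀ y, ‖v y‖ ≤ 1) : ‖v‖ ^ 2 ≤ S.ncard := by
  classical
  rw [EuclideanSpace.norm_sq_eq, Set.ncard_eq_toFinset_card', Finset.cast_card,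
    ← Finset.sum_subset (Finset.subset_univ S.toFinset)]
  · refine Finset.sum_le_sum fun y _ => ?_
    exact pow_le_one₀ (norm_nonneg _) (h1 y)
  · intro y _ hy
    rw [h0 y (by simpa using hy)]
    simp

theorem ncard_le_norm_sq [Fintype Y] {v : EuclideanSpace ℂ Y} {S : Set Y}
    (h : ∀ y ∈ S, 1 / 2 ≤ ‖v y‖) : (S.ncard : ℝ) ≤ 4 * ‖v‖ ^ 2 := by
  classical
  rw [EuclideanSpace.norm_sq_eq, Set.ncard_eq_toFinset_card', Finset.cast_card, Finset.mul_sum]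
  refine (Finset.sum_le_sum fun y hy => ?_).trans
    (Finset.sum_le_sum_of_subset_of_nonneg (Finset.subset_univ S.toFinset)
      fun _ _ _ => by positivity)
  have := h y (by simpa using hy)
  nlinarith

/-- Almost invariant subsets of finite actions of a Kazhdan group are close to invariant ones. -/
theorem IsKazhdanPair.exists_invariant_set {K : Finset N} {κ : ℝ} (h : IsKazhdanPair K κ)
    (hκ : 0 < κ) [Finite Y] (τ : N →* Equiv.Perm Y) (B : Set Y) :
    ∃ C : Set Y, (∀ g y, τ g y ∈ C ↔ y ∈ C) ∧
      ∀ δ : ℝ, 0 ≤ δ → (∀ k ∈ K, ((symmDiff (τ k '' B) B).ncard : ℝ) ≤ δ) →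
        κ ^ 2 * (symmDiff B C).ncard ≤ 4 * δ := by
  classical
  have := Fintype.ofFinite Y
  let v : EuclideanSpace ℂ Y := WithLp.toLp 2 fun y => if y ∈ B then 1 else 0
  have hv : ∀ y, v y = if y ∈ B then 1 else 0 := fun _ => rfl
  obtain ⟨w, hw, hnear⟩ := h.exists_invariant_near (permRep τ) v
  have hw' : ∀ g y, w (τ g y) = w y := fun g y => by
    conv_lhs => rw [← hw g, permRep_apply, Equiv.symm_apply_apply]
  -- Round the invariant vector near the indicator of `B` to a set. Wherever this set differs from
  -- `B`, the two vectors differ by at least `1/2`, which produces the factor 4.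
  refine ⟨{y | 1 / 2 < (w y).re}, fun g y => by simp only [Set.mem_ofPred_eq, hw'],
    fun δ hδ hK => ?_⟩
  have h1 : κ * ‖v - w‖ ≤ √δ := by
    refine hnear _ (Real.sqrt_nonneg _) fun k hk => Real.le_sqrt_of_sq_le ?_
    refine (norm_sq_le_ncard (S := symmDiff (τ k '' B) B) (fun y hy => ?_) fun y => ?_).trans
      (hK k hk)
    · rw [PiLp.sub_apply, permRep_apply, hv, hv]
      rw [Set.mem_symmDiff, Equiv.image_eq_preimage_symm, Set.mem_preimage] at hy
      by_cases ha : (τ k).symm y ∈ B <;> by_cases hb : y ∈ B <;> simp_all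
    · rw [PiLp.sub_apply, permRep_apply, hv, hv]
      split_ifs <;> simp
  have h2 : κ ^ 2 * ‖v - w‖ ^ 2 ≤ δ := by
    rw [← mul_pow, ← Real.sq_sqrt hδ]
    exact pow_le_pow_left₀ (by positivity) h1 2
  have h3 : ((symmDiff B {y | 1 / 2 < (w y).re}).ncard : ℝ) ≤ 4 * ‖v - w‖ ^ 2 := by
    refine ncard_le_norm_sq fun y hy => le_trans ?_ (Complex.abs_re_le_norm _)
    rw [PiLp.sub_apply, hv, Complex.sub_re]
    rcases hy with ⟨hB, hC⟩ | ⟨hC, hB⟩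
    · rw [if_pos hB, Complex.one_re]
      have : (w y).re ≤ 1 / 2 := not_lt.1 hC
      exact le_trans (by linarith) (le_abs_self _)
    · rw [if_neg hB, Complex.zero_re]
      have : 1 / 2 < (w y).re := hC
      exact le_trans (by linarith) (neg_le_abs _)
  nlinarith [mul_le_mul_of_nonneg_left h3 (sq_nonneg κ)]

end Kazhdan

/-! ### Making a finite action factor through the quotient. -/

section QuotientAction

variable {G : Type*} [Group G] (N : Subgroup G) [N.Normal] {Y : Type}

/-- The orbit equivalence relation of a normal subgroup of a group acting on `Y`. -/
def orbitSetoid (τ : G →* Equiv.Perm Y) : Setoid Y where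
  r y z := ∃ n ∈ N, τ n y = z
  iseqv :=
    { refl := fun y => ⟨1, N.one_mem, by simp⟩
      symm := by
        rintro y _ ⟨n, hn, rfl⟩
        exact ⟨n⁻¹, N.inv_mem hn, by simp⟩
      trans := by
        rintro y _ _ ⟨n, hn, rfl⟩ ⟨m, hm, rfl⟩
        exact ⟨m * n, N.mul_mem hm hn, by simp⟩ }

/-- The action of `G` on the orbits of a normal subgroup. -/
def orbitPerm (τ : G →* Equiv.Perm Y) : G →* Equiv.Perm (Quotient (orbitSetoid N τ)) :=
  MonoidHom.toHomPerm
    { toFun := fun g => Quotient.map (τ g) (by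
        rintro y _ ⟨n, hn, rfl⟩
        exact ⟨g * n * g⁻¹, Subgroup.Normal.conj_mem inferInstance n hn g, by simp⟩)
      map_one' := by
        funext ω
        induction ω using Quotient.inductionOn with | _ y =>
        exact congrArg (Quotient.mk _) (by simp)
      map_mul' := fun g h => by
        funext ω
        induction ω using Quotient.inductionOn with | _ y =>
        exact congrArg (Quotient.mk _) (by simp) }

theorem orbitPerm_mk (τ : G →* Equiv.Perm Y) (g : G) (y : Y) :
    orbitPerm N τ g (Quotient.mk _ y) = Quotient.mk _ (τ g y) := rfl

/-- By normality `g` carries `N`-orbits bijectively to `N`-orbits, so numberings of the orbits can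
be transported along `G`. -/
theorem card_fiber_orbitPerm (τ : G →* Equiv.Perm Y) (g : G) (ω : Quotient (orbitSetoid N τ)) :
    Nat.card {y // Quotient.mk (orbitSetoid N τ) y = orbitPerm N τ g ω} =
      Nat.card {y // Quotient.mk (orbitSetoid N τ) y = ω} := by
  refine (Nat.card_congr ((τ g).subtypeEquiv fun y => ?_)).symm
  rw [← orbitPerm_mk, (orbitPerm N τ g).injective.eq_iff]

/-- An action of `G` on a finite set can be changed along the orbits of a normal subgroup `N` to
an action on the same set that factors through `G ⧸ N`. -/
theorem exists_quotient_action [Finite Y] (τ : G →* Equiv.Perm Y) :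
    ∃ τ' : (G ⧸ N) →* Equiv.Perm Y, ∀ C : Set Y, (∀ n ∈ N, ∀ y, τ n y ∈ C ↔ y ∈ C) →
      ∀ g : G, τ' g '' C = τ g '' C := by
  let mk : Y → Quotient (orbitSetoid N τ) := Quotient.mk _
  let c : Quotient (orbitSetoid N τ) → ℕ := fun ω => Nat.card {y // mk y = ω}
  -- A point is encoded by its orbit and its number within that orbit.
  let j : Y → {p : Quotient (orbitSetoid N τ) × ℕ // p.2 < c p.1} := fun y =>
    ⟨(mk y, Finite.equivFin {z // mk z = mk y} ⟨y, rfl⟩), Fin.is_lt _⟩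
  have hj : Function.Bijective j := by
    constructor
    -- The numbering depends on the orbit, so equal numbers are comparable only after identifying
    -- the two orbits; a free `ω` makes that substitution possible.
    · have key : ∀ ω y z (hy : mk y = ω) (hz : mk z = ω),
          ((Finite.equivFin {z // mk z = mk y} ⟨y, rfl⟩ : Fin _) : ℕ) =
            (Finite.equivFin {y // mk y = mk z} ⟨z, rfl⟩ : Fin _) → y = z := by
        rintro _ y z hy rfl h
        have h' : ∀ ω (hy : mk y = ω), ((Finite.equivFin {z // mk z = mk y} ⟨y, rfl⟩ : Fin _) : ℕ)
            = (Finite.equivFin {z // mk z = ω} ⟨y, hy⟩ : Fin _) := by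
          rintro _ rfl
          rfl
        rw [h' _ hy] at h
        exact congrArg Subtype.val ((Finite.equivFin _).injective (Fin.ext h))
      intro y z h
      have h1 := congrArg Subtype.val h
      exact key (mk z) y z (congrArg Prod.fst h1) rfl (congrArg Prod.snd h1)
    · rintro ⟨⟨ω, k⟩, hk⟩
      obtain ⟨⟨y, rfl⟩, hy⟩ := (Finite.equivFin {y // mk y = ω}).surjective ⟨k, hk⟩
      refine ⟨y, Subtype.ext (Prod.ext rfl ?_)⟩
      exact congrArg Fin.val hy
  let e := Equiv.ofBijective j hj
  -- Orbits move and numbers stay, so `N`, which fixes every orbit, acts trivially.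
  let act : G →* Equiv.Perm {p : Quotient (orbitSetoid N τ) × ℕ // p.2 < c p.1} :=
    { toFun := fun g => Equiv.Perm.subtypePerm ((orbitPerm N τ g).prodCongr (Equiv.refl ℕ))
        fun p => by
          change p.2 < c (orbitPerm N τ g p.1) ↔ p.2 < c p.1
          rw [show c (orbitPerm N τ g p.1) = c p.1 from card_fiber_orbitPerm N τ g p.1]
      map_one' := by
        ext p : 2
        change ((orbitPerm N τ 1 p.1.1, p.1.2) : _ × ℕ) = p.1
        rw [map_one]
        rfl
      map_mul' := fun g h => by
        ext p : 2
        change ((orbitPerm N τ (g * h) p.1.1, p.1.2) : _ × ℕ) =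
          (orbitPerm N τ g (orbitPerm N τ h p.1.1), p.1.2)
        rw [map_mul]
        rfl }
  let act' : G →* Equiv.Perm Y := (Equiv.permCongrHom e.symm).toMonoidHom.comp act
  have hmk : ∀ g y, mk (act' g y) = mk (τ g y) := fun g y => by
    have h1 : ∀ y, (e y).1.1 = mk y := fun _ => rfl
    rw [← h1]
    change (e (e.symm (act g (e.symm.symm y)))).1.1 = _
    rw [Equiv.apply_symm_apply]
    rfl
  have hker : N ≤ act'.ker := fun n hn => by
    have : act n = 1 := by
      ext p : 2
      refine Prod.ext ?_ rfl
      change orbitPerm N τ n p.1.1 = p.1.1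
      obtain ⟨y, hy⟩ := Quotient.exists_rep p.1.1
      rw [← hy, orbitPerm_mk]
      exact (Quotient.sound (s := orbitSetoid N τ) ⟨n, hn, rfl⟩).symm
    rw [MonoidHom.mem_ker, MonoidHom.comp_apply, this, map_one]
  refine ⟨QuotientGroup.lift N act' hker, fun C hC g => ?_⟩
  have hC' : ∀ y z, mk y = mk z → (y ∈ C ↔ z ∈ C) := fun y z h => by
    obtain ⟨n, hn, rfl⟩ := Quotient.exact h
    exact (hC n hn y).symm
  change act' g '' C = τ g '' C
  ext y
  rw [Equiv.image_eq_preimage_symm, Equiv.image_eq_preimage_symm]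
  -- Membership in `C` depends only on the orbit, and the preimages of `y` under the old and new
  -- actions of `g` lie in the same orbit.
  refine hC' _ _ ?_
  apply (orbitPerm N τ g).injective
  change mk (τ g _) = mk (τ g _)
  rw [← hmk, Equiv.apply_symm_apply, Equiv.apply_symm_apply]

end QuotientAction

/-! ### Asymptotically free finite actions. -/

section ResiduallyFinite

variable {G : Type*} [Group G]

theorem exists_fixedPointFree_action [Group.ResiduallyFinite G] {g : G} (hg : g ≠ 1) :
    ∃ (Z : Type) (_ : Finite Z) (_ : Nonempty Z) (θ : G →* Equiv.Perm Z), ∀ z, θ g z ≠ z := by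
  obtain ⟨H, hH⟩ := Group.exists_finiteIndexNormalSubgroup_notMem g hg
  -- Transport to `Fin` places the action in `Type`, whatever the universe of `G`.
  let e := Finite.equivFin (G ⧸ H.toSubgroup)
  refine ⟨_, inferInstance, ⟨e 1⟩,
    (Equiv.permCongrHom e).toMonoidHom.comp (MulAction.toPermHom G (G ⧸ H.toSubgroup)),
    fun z hz => hH ?_⟩
  have h1 : e (g • e.symm z) = z := hz
  rw [← Equiv.eq_symm_apply] at h1
  obtain ⟨x, hx⟩ := QuotientGroup.mk_surjective (e.symm z)
  rw [← hx] at h1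
  have h2 : ((g : G ⧸ H.toSubgroup) * (x : G ⧸ H.toSubgroup)) = x := h1
  exact (QuotientGroup.eq_one_iff g).1 (mul_eq_right.1 h2)

/-- Enumerate `G` and take finite products: an element moves every point of a product as soon as it
does so in one factor. -/
theorem exists_asymptotically_free_actions [Countable G] [Group.ResiduallyFinite G] :
    ∃ (Z : ℕ → Type) (_ : ∀ n, Finite (Z n)) (_ : ∀ n, Nonempty (Z n))
      (θ : ∀ n, G →* Equiv.Perm (Z n)),
      ∀ g : G, g ≠ 1 → ∀ᶠ n in atTop, ∀ z, θ n g z ≠ z := by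
  obtain ⟨e, he⟩ := exists_surjective_nat G
  have key : ∀ n : ℕ, ∃ (Z : Type) (_ : Finite Z) (_ : Nonempty Z) (θ : G →* Equiv.Perm Z),
      ∀ k < n, e k ≠ 1 → ∀ z, θ (e k) z ≠ z := by
    intro n
    induction n with
    | zero => exact ⟨Unit, inferInstance, inferInstance, 1, fun k hk => absurd hk k.not_lt_zero⟩
    | succ n ih =>
      obtain ⟨Z, _, _, θ, hθ⟩ := ih
      by_cases h1 : e n = 1
      · refine ⟨Z, inferInstance, inferInstance, θ, fun k hk hk1 => hθ k ?_ hk1⟩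
        rcases Nat.lt_succ_iff_lt_or_eq.1 hk with h | rfl
        · exact h
        · exact absurd h1 hk1
      obtain ⟨W, _, _, φ, hφ⟩ := exists_fixedPointFree_action h1
      refine ⟨Z × W, inferInstance, inferInstance,
        { toFun := fun g => (θ g).prodCongr (φ g)
          map_one' := by ext <;> simp
          map_mul' := fun g h => by ext <;> simp }, fun k hk hk1 z hz => ?_⟩
      rcases Nat.lt_succ_iff_lt_or_eq.1 hk with h | rfl
      · exact hθ k h hk1 _ (congrArg Prod.fst hz)
      · exact hφ _ (congrArg Prod.snd hz)
  choose Z h1 h2 θ hθ using key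
  refine ⟨Z, h1, h2, θ, fun g hg => ?_⟩
  obtain ⟨k, rfl⟩ := he g
  filter_upwards [eventually_gt_atTop k] with n hn
  exact hθ n k hn hg

end ResiduallyFinite

/-! ### Stability passes to the quotient by a Kazhdan subgroup. -/

section Descent

variable {G : Type*} [Group G]

/-- The product of a sofic approximation of a quotient with asymptotically free actions. -/
theorem IsSoficApproximation.prod_free {Q : Type*} [Group Q] (π : G →* Q) {X Z : ℕ → Type}
    [∀ n, Finite (X n)] [∀ n, Nonempty (X n)] [∀ n, Finite (Z n)] [∀ n, Nonempty (Z n)]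
    {σ : ∀ n, Q → Equiv.Perm (X n)} (hσ : IsSoficApproximation σ)
    (θ : ∀ n, G →* Equiv.Perm (Z n))
    (hθ : ∀ g : G, g ≠ 1 → ∀ᶠ n in atTop, ∀ z, θ n g z ≠ z) :
    IsSoficApproximation fun n (g : G) => (σ n (π g)).prodCongr (θ n g) where
  mul g h := by
    refine (hσ.mul (π g) (π h)).congr fun n => ?_
    unfold hammingDistance
    rw [← dens_fst_preimage (Y := Z n)]
    congr 1
    ext p
    simp [Prod.ext_iff]
  free g hg := by
    refine tendsto_const_nhds.congr' ?_
    filter_upwards [hθ g hg] with n hn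
    unfold hammingDistance
    rw [← dens_univ (X := X n × Z n)]
    congr 1
    refine (Set.eq_univ_of_forall fun p hp => hn p.2 (congrArg Prod.snd hp)).symm

theorem dens_symmDiff {X : Type*} [Finite X] (A B : Set X) :
    dens (symmDiff A B) = dens A + dens B - 2 * dens (A ∩ B) := by
  have h1 := Set.ncard_inter_add_ncard_sdiff_eq_ncard A B
  have h2 := Set.ncard_inter_add_ncard_sdiff_eq_ncard B A
  have h3 : (symmDiff A B).ncard = (A \ B).ncard + (B \ A).ncard :=
    Set.ncard_union_eq disjoint_sdiff_sdiff
  rw [Set.inter_comm B A] at h2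
  unfold dens
  rw [h3, ← h1, ← h2]
  push_cast
  ring

theorem abs_dens_image_inter_sub_le {Y : Type*} [Finite Y] (s : Equiv.Perm Y)
    (A A' B B' : Set Y) :
    |dens (s '' A ∩ B) - dens (s '' A' ∩ B')| ≤ dens (symmDiff A A') + dens (symmDiff B B') := by
  refine (abs_dens_sub_le _ _).trans ?_
  rw [← dens_image_equiv s (symmDiff A A'), Set.image_symmDiff s.injective]
  refine (dens_mono fun y hy => ?_).trans (dens_union_le _ _)
  simp only [Set.mem_symmDiff, Set.mem_inter_iff, Set.mem_union] at hy ⊢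
  tauto

theorem StableInFiniteActions.quotient [Countable G] [Group.ResiduallyFinite G]
    (hstable : StableInFiniteActions G) (N : Subgroup G) [N.Normal] (hN : IsKazhdan N) :
    StableInFiniteActions (G ⧸ N) := by
  classical
  intro X _ _ σ hσ U hU d A hA F ε hε
  obtain ⟨K, κ, hκ, hK⟩ := hN
  have hpair : IsKazhdanPair K κ := hK
  obtain ⟨Z, _, _, θ, hθ⟩ := exists_asymptotically_free_actions (G := G)
  let p : ∀ n, X n × Z n → X n := fun n => Prod.fst
  let σ' : ∀ n, G → Equiv.Perm (X n × Z n) := fun n g => (σ n (g : G ⧸ N)).prodCongr (θ n g)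
  have hσ' : IsSoficApproximation σ' := hσ.prod_free (QuotientGroup.mk' N) θ hθ
  have hmap := map_ultraMap_loebMeasure U hU p fun n A => dens_fst_preimage A
  have hμ : ∀ (g : G) i j,
      (loebMeasure U fun n => X n × Z n).real
        (limitAction U σ' g '' (ultraMap U p ⁻¹' A i) ∩ ultraMap U p ⁻¹' A j) =
      (loebMeasure U X).real (limitAction U σ (g : G ⧸ N) '' A i ∩ A j) := by
    intro g i j
    have h1 : limitAction U σ' g '' (ultraMap U p ⁻¹' A i) =
        ultraMap U p ⁻¹' (limitAction U σ (g : G ⧸ N) '' A i) :=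
      ultraPerm_image_preimage U p _ _ (fun n x => rfl) _
    have h2 : MeasurableSet (limitAction U σ (g : G ⧸ N) '' A i ∩ A j) :=
      (measurableSet_ultraPerm_image U _ (hA i)).inter (hA j)
    rw [h1, ← Set.preimage_inter, ← hmap, map_measureReal_apply (measurable_ultraMap U p) h2]
  have hδ : 0 < ε * κ ^ 2 / (2 * (κ ^ 2 + 32)) := by positivity
  -- Chosen so that the final error, `δ` from the model plus `16 * δ / κ ^ 2` for each of two sets,
  -- equals `ε / 2`.
  set δ := ε * κ ^ 2 / (2 * (κ ^ 2 + 32)) with hδ_def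
  obtain ⟨Y, _, _, τ, B, hB⟩ := hstable (fun n => X n × Z n) σ' hσ' U hU d
    (fun i => ultraMap U p ⁻¹' A i) (fun i => measurable_ultraMap U p (hA i))
    -- The element `1` controls the sizes of the `B i`, the Kazhdan set their almost invariance, and
    -- the coset representatives the correlations to be matched.
    (insert 1 (K.image Subtype.val ∪ F.image Quotient.out)) δ hδ
  simp only [hμ] at hB
  choose C hC hBC using fun i => hpair.exists_invariant_set hκ (τ.comp N.subtype) (B i)
  have hY : (0 : ℝ) < Nat.card Y := by exact_mod_cast Nat.card_pos
  have hfix : ∀ n : G, (n : G ⧸ N) = 1 → n ∈ insert 1 (K.image Subtype.val ∪ F.image Quotient.out) →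
      ∀ i, |(loebMeasure U X).real (A i) - dens (τ n '' B i ∩ B i)| < δ := by
    intro n hn hmem i
    have := hB n hmem i i
    rwa [hn, hσ.loebMeasure_real_image_one_inter U hU] at this
  have hclose : ∀ i, dens (symmDiff (B i) (C i)) ≤ 16 * δ / κ ^ 2 := by
    intro i
    -- The symmetric difference has density twice the gap between `dens (B i)` and the
    -- self-correlation at `k`. Both are within `δ` of the measure of `A i`, hence `4 * δ`.
    have h := hBC i (4 * δ * Nat.card Y) (by positivity) fun k hk => by
      have h1 := hfix 1 rfl (Finset.mem_insert_self _ _) i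
      rw [map_one, Equiv.Perm.coe_one, Set.image_id, Set.inter_self] at h1
      have h2 := hfix k ((QuotientGroup.eq_one_iff _).2 k.2)
        (Finset.mem_insert_of_mem (Finset.mem_union_left _ (Finset.mem_image_of_mem _ hk))) i
      have h3 := dens_symmDiff (τ k '' B i) (B i)
      rw [dens_image_equiv] at h3
      rw [← div_le_iff₀ hY]
      change dens (symmDiff (τ k '' B i) (B i)) ≤ _
      rw [abs_lt] at h1 h2
      linarith [h1.1, h2.2]
    unfold dens
    rw [div_le_div_iff₀ hY (by positivity)]
    linarith
  obtain ⟨τ', hτ'⟩ := exists_quotient_action N τ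
  refine ⟨Y, inferInstance, inferInstance, τ', C, fun q hq i j => ?_⟩
  have hq' : ((Quotient.out q : G) : G ⧸ N) = q := QuotientGroup.out_eq' q
  have h1 := hB (Quotient.out q) (Finset.mem_insert_of_mem (Finset.mem_union_right _
    (Finset.mem_image_of_mem _ hq))) i j
  have h2 := hτ' (C i) (fun n hn y => hC i ⟨n, hn⟩ y) (Quotient.out q)
  rw [hq'] at h1 h2
  rw [h2]
  have h3 := abs_dens_image_inter_sub_le (τ (Quotient.out q)) (B i) (C i) (B j) (C j)
  refine (abs_sub_le _ _ _).trans_lt ((add_lt_add_of_lt_of_le h1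
    (h3.trans (add_le_add (hclose i) (hclose j)))).trans ?_)
  have : δ + (16 * δ / κ ^ 2 + 16 * δ / κ ^ 2) = ε / 2 := by
    rw [hδ_def]
    field_simp
    ring
  rw [this]
  exact half_lt_self hε

end Descent

/-! ### Stable sofic groups are residually finite. -/

section Sofic

/-- Take `A` maximal among sets disjoint from their image. A moved point that cannot be added to `A`
lies in `A`, `s '' A` or `s.symm '' A`, three sets of equal density. -/
theorem exists_displaced_set {X : Type*} [Finite X] (s : Equiv.Perm X) :
    ∃ A : Set X, Disjoint (s '' A) A ∧ dens {x | s x ≠ x} ≤ 3 * dens A := by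
  obtain ⟨A, hA⟩ := (Set.toFinite {A : Set X | ∀ x ∈ A, s x ∉ A}).exists_maximal
    ⟨∅, fun x hx => hx.elim⟩
  refine ⟨A, ?_, ?_⟩
  · rw [Set.disjoint_left]
    rintro _ ⟨x, hx, rfl⟩
    exact hA.prop x hx
  have hcov : {x | s x ≠ x} ⊆ A ∪ (s '' A ∪ s.symm '' A) := by
    intro x hx
    by_contra hn
    rw [Set.mem_union, Set.mem_union, not_or, not_or, Equiv.image_eq_preimage_symm,
      Equiv.image_eq_preimage_symm, Equiv.symm_symm] at hn
    refine hn.1 (hA.le_of_ge (y := insert x A) ?_ (Set.subset_insert x A) (Set.mem_insert x A))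
    rintro y (rfl | hy) (h | h)
    · exact hx h
    · exact hn.2.2 h
    · refine hn.2.1 ?_
      rw [← h]
      simpa using hy
    · exact hA.prop y hy h
  refine (dens_mono hcov).trans ((dens_union_le _ _).trans ?_)
  have := dens_union_le (s '' A) (s.symm '' A)
  rw [dens_image_equiv, dens_image_equiv] at this
  linarith

theorem StableInFiniteActions.residuallyFinite {Q : Type*} [Group Q]
    (hstable : StableInFiniteActions Q) (hQ : IsSofic Q) : Group.ResiduallyFinite Q := by
  classical
  obtain ⟨X, _, _, σ, hσ⟩ := hQ
  let U := hyperfilter ℕ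
  have hU : (U : Filter ℕ) ≤ cofinite := hyperfilter_le_cofinite
  refine Group.residuallyFinite_of_forall_exists_finite_monoidHom fun q hq => ?_
  choose A hA hdens using fun n => exists_displaced_set (σ n q)
  have hempty : limitAction U σ q '' internal U A ∩ internal U A = ∅ := by
    rw [← Set.disjoint_iff_inter_eq_empty, Set.disjoint_left]
    rintro _ ⟨x, hx, rfl⟩ hx'
    induction x using Quotient.inductionOn with | _ f =>
    obtain ⟨n, h1, h2⟩ := (((mk_mem_internal U).1 hx).and
      ((mk_mem_internal U (f := fun n => σ n q (f n))).1 hx')).exists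
    exact Set.disjoint_left.1 (hA n) (Set.mem_image_of_mem _ h1) h2
  have hlarge : 1 / 3 ≤ (loebMeasure U X).real (internal U A) := by
    have hfree := ENNReal.tendsto_ofReal
      (((hσ.free q hq).mono_left (hU.trans Nat.cofinite_eq_atTop.le)).div_const 3)
    have hle : ENNReal.ofReal (1 / 3) ≤ limDens U A :=
      le_of_tendsto_of_tendsto' hfree (tendsto_limDens U A) fun n => by
        refine ENNReal.ofReal_le_ofReal ?_
        have : hammingDistance (σ n q) 1 ≤ 3 * dens (A n) := hdens n
        linarith
    rw [← loebMeasure_internal U hU] at hle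
    have := isProbabilityMeasure_loebMeasure U (X := X) hU
    exact (ENNReal.ofReal_le_iff_le_toReal (measure_ne_top _ _)).1 hle
  obtain ⟨Y, _, _, τ, B, hB⟩ := hstable X σ hσ U hU 1 (fun _ => internal U A)
    -- With tolerance `1 / 6`, the element `1` forces `dens (B 0) > 1 / 6`, while a trivial action
    -- of `q` would force `dens (B 0) < 1 / 6`.
    (fun _ => measurableSet_internal U A) (insert 1 {q}) (1 / 6) (by norm_num)
  refine ⟨Equiv.Perm Y, inferInstance, inferInstance, τ, fun h => ?_⟩
  have h1 := hB 1 (by simp) 0 0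
  have h2 := hB q (by simp) 0 0
  rw [hσ.loebMeasure_real_image_one_inter U hU, map_one, abs_lt] at h1
  rw [hempty, measureReal_empty, h, abs_lt] at h2
  linarith [h1.2, h2.1]

end Sofic

end FiniteActions

end

theorem mainTheorem8 {G : Type*} [Group G] [Countable G] (N : Subgroup G) [N.Normal]
    (hG : Group.ResiduallyFinite G) (hN : FiniteActions.IsKazhdan N)
    (hstable : FiniteActions.StableInFiniteActions G) :
    FiniteActions.StableInFiniteActions (G ⧸ N) ∧
      (FiniteActions.IsSofic (G ⧸ N) → Group.ResiduallyFinite (G ⧸ N)) :=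
  ⟨hstable.quotient N hN, (hstable.quotient N hN).residuallyFinite⟩
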